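/- Let $\mathbb{D}$ be the open unit disc and $dA$ normalized Lebesgue area measure on $\mathbb{D}$. A variable exponent on $\mathbb{D}$ is a measurable function $p:\mathbb{D}\to\mathbb{R}$ with $0<\operatorname{ess\,inf} p\le\operatorname{ess\,sup} p<\infty$; it is radial if $p(z)=p(|z|)$ for all $z\in\mathbb{D}$. For such $p$, let $A^{p(\cdot)}$ be the set of analytic functions $f$ on $\mathbb{D}$ with $$\int_{\mathbb{D}}|f(z)|^{p(z)}\,dA(z)<\infty,$$ and write $A^q$ for this space when $p\equiv q$ is a positive constant. Let $0<q<\infty$. (1) There is a radial variable exponent $p$ on $\mathbb{D}$ with $p(z)\ge q$ for all $z\in\mathbb{D}$ and $p(r)\to q$ as $r\to1^-$, but $A^{p(\cdot)}\ne A^q$ as sets. (2) Explicitly, let $p$ be any radial variable exponent on $\mathbb{D}$ for which there is some $0<R<1$ with $$p(r)=q+\frac q2\bigl(-\log(1-r)\bigr)^{-1/2}\qquad\text{for } R\le r<1.$$ Then $p(r)\to q$ as $r\to1^-$ and $A^{p(\cdot)}\ne A^q$. -/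

import Mathlib

open MeasureTheory Filter Topology Set

noncomputable section

namespace VariableBergman

/-- The open unit disc of `ℂ`. -/
def disc : Set ℂ := Metric.ball (0 : ℂ) 1

/-- Normalized Lebesgue area measure `dA` on the unit disc (total mass `1`),
viewed as a measure on `ℂ` carried by the disc. -/
def areaMeasure : Measure ℂ := (volume disc)⁻¹ • volume.restrict disc

/-- `p` is a variable exponent on the disc: measurable on the disc with
`0 < ess inf p ≤ ess sup p < ∞`. The essential bounds are taken in the complete lattice
`EReal`, so that they have their true (possibly infinite) values.
The values of `p` outside the disc are irrelevant. -/
structure IsVariableExponent (p : ℂ → ℝ) : Prop where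
  measurable : Measurable (disc.domRestrict p)
  essInf_pos : 0 < essInf (fun z => (p z : EReal)) areaMeasure
  essSup_lt_top : essSup (fun z => (p z : EReal)) areaMeasure < ⊤

/-- `p` is radial: on the disc, `p z` depends only on `|z|`. -/
def IsRadial (p : ℂ → ℝ) : Prop :=
  ∀ z ∈ disc, p z = p ((‖z‖ : ℝ) : ℂ)

/-- The modular `ρ_p(f) = ∫_𝔻 |f(z)|^{p(z)} dA(z)`, with values in `[0, ∞]`. -/
def modular (p : ℂ → ℝ) (f : ℂ → ℂ) : ENNReal :=
  ∫⁻ z, ‖f z‖ₑ ^ (p z) ∂areaMeasure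

/-- Membership in the variable exponent Lebesgue space `L^{p(·)}` of the disc. -/
def MemLpVar (p : ℂ → ℝ) (f : ℂ → ℂ) : Prop :=
  AEMeasurable f areaMeasure ∧ modular p f < ⊤

/-- The unweighted variable exponent Bergman space `A^{p(·)}`: the functions in `L^{p(·)}` that
are analytic in the disc. A function on the disc is represented by functions `ℂ → ℂ`
with arbitrary values outside the disc; these values do not affect membership. -/
def bergmanSpace (p : ℂ → ℝ) : Set (ℂ → ℂ) :=
  {f | DifferentiableOn ℂ f disc ∧ MemLpVar p f}

end VariableBergman

end

namespace VariableBergman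

/-! The test function f = ((1 - z)(2 - log (1 - z))) ^ (-2/q) separates the spaces. Put t = |1 - z|
and l = -log t. At exponent q, |f|^q is at most (t(2 - log t))⁻², and the polar integral of 1/(t(2 -
log t)²) converges at 0. The logarithm makes this only barely so. At exponent p, 2p/q = 2 + L^(-1/2)
with L = -log (1 - |z|). In a sector at 1, L and |2 - log (1 - z)| are at most l + 3, so the extra
exponent gains a factor of order exp(√l), which beats the logarithmic loss (l + 3)². Hence |f|^p ≥
t⁻² there, and the polar integral of 1/t diverges (`inv_sq_le_exp`,
`setLIntegral_disc_eq_top_of_sector`). -/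

/-- The function `((1 - z) (2 - log (1 - z))) ^ (-2 / q)` on the disc. -/
noncomputable def logPole (q : ℝ) (z : ℂ) : ℂ :=
  Complex.exp (((-(2 / q) : ℝ) : ℂ) *
    (Complex.log (1 - z) + Complex.log (2 - Complex.log (1 - z))))

theorem norm_logPole (q : ℝ) (z : ℂ) :
    ‖logPole q z‖ =
      Real.exp (-(2 / q) * (Real.log ‖1 - z‖ + Real.log ‖2 - Complex.log (1 - z)‖)) := by
  rw [logPole, Complex.norm_exp, Complex.re_ofReal_mul, Complex.add_re, Complex.log_re,
    Complex.log_re]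

theorem enorm_logPole_rpow (q s : ℝ) (z : ℂ) :
    ‖logPole q z‖ₑ ^ s = ENNReal.ofReal (Real.exp
      (-(2 * (s / q)) * (Real.log ‖1 - z‖ + Real.log ‖2 - Complex.log (1 - z)‖))) := by
  rw [← ofReal_norm, norm_logPole, ENNReal.ofReal_rpow_of_pos (Real.exp_pos _),
    ← Real.exp_mul]
  congr 2
  ring

theorem isOpen_disc : IsOpen disc := Metric.isOpen_ball

theorem mem_disc_iff {z : ℂ} : z ∈ disc ↔ ‖z‖ < 1 := by simp [disc]

theorem one_sub_re_pos {z : ℂ} (hz : z ∈ disc) : 0 < (1 - z).re := by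
  have := (Complex.re_le_norm z).trans_lt (mem_disc_iff.1 hz)
  simpa using this

theorem norm_one_sub_lt_two {z : ℂ} (hz : z ∈ disc) : ‖1 - z‖ < 2 := by
  have h := norm_sub_le (1 : ℂ) z
  have := mem_disc_iff.1 hz
  rw [norm_one] at h
  linarith

theorem norm_one_sub_pos {z : ℂ} (hz : z ∈ disc) : 0 < ‖1 - z‖ :=
  (one_sub_re_pos hz).trans_le (Complex.re_le_norm _)

theorem log_lt_one_of_lt_two {t : ℝ} (h0 : 0 < t) (h : t < 2) : Real.log t < 1 := by
  have := Real.log_le_sub_one_of_pos h0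
  linarith

theorem re_two_sub_log (w : ℂ) : (2 - Complex.log w).re = 2 - Real.log ‖w‖ := by
  simp [Complex.log_re]

theorem re_two_sub_log_pos {z : ℂ} (hz : z ∈ disc) : 0 < (2 - Complex.log (1 - z)).re := by
  rw [re_two_sub_log]
  linarith [log_lt_one_of_lt_two (norm_one_sub_pos hz) (norm_one_sub_lt_two hz)]

theorem differentiableOn_logPole (q : ℝ) : DifferentiableOn ℂ (logPole q) disc := by
  intro z hz
  have h1 : DifferentiableAt ℂ (fun z : ℂ => 1 - z) z := by fun_prop
  have h2 : DifferentiableAt ℂ (fun z : ℂ => Complex.log (1 - z)) z :=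
    h1.clog (Or.inl (one_sub_re_pos hz))
  have h3 : DifferentiableAt ℂ (fun z : ℂ => Complex.log (2 - Complex.log (1 - z))) z :=
    (h2.const_sub 2).clog (Or.inl (re_two_sub_log_pos hz))
  exact ((h2.add h3).const_mul _).cexp.differentiableWithinAt

theorem aemeasurable_logPole (q : ℝ) : AEMeasurable (logPole q) areaMeasure :=
  ((differentiableOn_logPole q).continuousOn.aemeasurable isOpen_disc.measurableSet).smul_measure _

theorem modular_lt_top_iff (p : ℂ → ℝ) (f : ℂ → ℂ) :
    modular p f < ⊤ ↔ ∫⁻ z in disc, ‖f z‖ₑ ^ (p z) < ⊤ := by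
  have h0 : (volume disc)⁻¹ ≠ 0 := ENNReal.inv_ne_zero.2 measure_ball_lt_top.ne
  have h1 : (volume disc)⁻¹ ≠ ⊤ :=
    ENNReal.inv_ne_top.2 (Metric.measure_ball_pos volume _ one_pos).ne'
  rw [modular, areaMeasure, lintegral_smul_measure, smul_eq_mul]
  constructor
  · intro h
    exact (ENNReal.mul_lt_top_iff.1 h).elim (fun h => h.2)
      (fun h => h.elim (fun h => absurd h h0) (fun h => h ▸ ENNReal.zero_lt_top))
  · exact fun h => ENNReal.mul_lt_top h1.lt_top h

/-! ### Integrability at the constant exponent -/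

theorem continuousOn_inv_two_sub_log_update :
    ContinuousOn (Function.update (fun t : ℝ => (2 - Real.log t)⁻¹) 0 0) (Icc 0 2) := by
  intro t ht
  rcases eq_or_ne t 0 with rfl | h0
  · refine continuousWithinAt_update_same.2 ?_
    have hsub : Icc (0 : ℝ) 2 \ {0} ⊆ Ioi 0 := fun t ht => lt_of_le_of_ne ht.1.1 (Ne.symm ht.2)
    refine Tendsto.mono_left ?_ (nhdsWithin_mono 0 hsub)
    refine Tendsto.inv_tendsto_atTop ?_
    simpa [sub_eq_add_neg] using tendsto_atTop_add_const_left _ (2 : ℝ)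
      (tendsto_neg_atBot_atTop.comp Real.tendsto_log_nhdsGT_zero)
  · refine ContinuousAt.continuousWithinAt ?_
    rw [continuousAt_update_of_ne h0]
    have hpos : 0 < t := lt_of_le_of_ne ht.1 h0.symm
    have : 2 - Real.log t ≠ 0 := by
      have := Real.log_le_sub_one_of_pos hpos
      linarith [ht.2]
    exact (continuousAt_const.sub (Real.continuousAt_log h0)).inv₀ this

/-- The integrand is the nonnegative derivative of (2 - log t)⁻¹, which extends continuously by 0 at
t = 0. -/
theorem integrableOn_inv_mul_inv_two_sub_log_sq :
    IntegrableOn (fun t : ℝ => t⁻¹ * ((2 - Real.log t) ^ 2)⁻¹) (Ioc 0 2) := by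
  refine intervalIntegral.integrableOn_deriv_of_nonneg continuousOn_inv_two_sub_log_update ?_ ?_
  · intro t ht
    have hne : 2 - Real.log t ≠ 0 := by
      linarith [log_lt_one_of_lt_two ht.1 ht.2]
    have h := ((Real.hasDerivAt_log ht.1.ne').const_sub 2).inv hne
    refine (h.congr_of_eventuallyEq ?_).congr_deriv ?_
    · filter_upwards [isOpen_ne.mem_nhds ht.1.ne'] with s hs
      rw [Function.update_of_ne hs]
      rfl
    · rw [neg_neg, div_eq_mul_inv]
  · intro t ht
    have := ht.1
    positivity

theorem integrable_radial_majorant :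
    Integrable (fun w : ℂ =>
      (Ioc (0 : ℝ) 2).indicator (fun t => ((t * (2 - Real.log t)) ^ 2)⁻¹) ‖w‖) := by
  rw [integrable_fun_norm_addHaar volume
    (f := (Ioc (0 : ℝ) 2).indicator (fun t => ((t * (2 - Real.log t)) ^ 2)⁻¹)),
    Complex.finrank_real_complex]
  have h : IntegrableOn ((Ioc (0 : ℝ) 2).indicator
      (fun t : ℝ => t⁻¹ * ((2 - Real.log t) ^ 2)⁻¹)) (Ioi 0) :=
    (integrableOn_inv_mul_inv_two_sub_log_sq.integrable_indicator measurableSet_Ioc).integrableOn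
  refine h.congr_fun ?_ measurableSet_Ioi
  intro t ht
  have ht0 : t ≠ 0 := ne_of_gt ht
  by_cases hm : t ∈ Ioc (0 : ℝ) 2
  · simp only [indicator_of_mem hm, smul_eq_mul]
    rw [mul_pow, mul_inv]
    norm_num
    field_simp
  · simp [indicator_of_notMem hm]

/-- Replacing |2 - log (1 - z)| by its real part makes the bound radial about 1. -/
theorem enorm_logPole_rpow_le {q : ℝ} (hq : 0 < q) {z : ℂ} (hz : z ∈ disc) :
    ‖logPole q z‖ₑ ^ q ≤ ENNReal.ofReal
      ((Ioc (0 : ℝ) 2).indicator (fun t => ((t * (2 - Real.log t)) ^ 2)⁻¹) ‖1 - z‖) := by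
  have h0 := norm_one_sub_pos hz
  have h2 := norm_one_sub_lt_two hz
  have hre := re_two_sub_log_pos hz
  have hle := Complex.re_le_norm (2 - Complex.log (1 - z))
  rw [re_two_sub_log] at hre hle
  have hN := hre.trans_le hle
  rw [enorm_logPole_rpow, indicator_of_mem (show ‖1 - z‖ ∈ Ioc (0 : ℝ) 2 from ⟨h0, h2.le⟩),
    div_self hq.ne', mul_one, ← Real.log_mul h0.ne' hN.ne', neg_mul, Real.exp_neg]
  have : Real.exp (2 * Real.log (‖1 - z‖ * ‖2 - Complex.log (1 - z)‖))
      = (‖1 - z‖ * ‖2 - Complex.log (1 - z)‖) ^ 2 := by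
    rw [two_mul, Real.exp_add, Real.exp_log (mul_pos h0 hN), sq]
  rw [this]
  refine ENNReal.ofReal_le_ofReal (inv_anti₀ (by positivity) ?_)
  gcongr

theorem logPole_mem_bergmanSpace_const {q : ℝ} (hq : 0 < q) :
    logPole q ∈ bergmanSpace (fun _ => q) := by
  refine ⟨differentiableOn_logPole q, aemeasurable_logPole q, ?_⟩
  rw [modular_lt_top_iff]
  have h := (integrable_radial_majorant.comp_sub_left (1 : ℂ)).lintegral_lt_top
  refine lt_of_le_of_lt ?_ h
  exact (setLIntegral_mono' isOpen_disc.measurableSet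
    (fun z hz => enorm_logPole_rpow_le hq hz)).trans (setLIntegral_le_lintegral _ _)

/-! ### Divergence at the variable exponent -/

theorem eventually_two_mul_log_le :
    ∀ᶠ l : ℝ in atTop,
      2 * Real.log (l + 3) ≤ (l + 3) ^ (-(1 / 2) : ℝ) * (l - Real.log (l + 3)) := by
  have hy : Tendsto (fun l : ℝ => l + 3) atTop atTop := tendsto_atTop_add_const_right _ _ tendsto_id
  have hlog : ∀ᶠ y : ℝ in atTop, Real.log y ≤ y ^ (1 / 4 : ℝ) := by
    filter_upwards [(isLittleO_log_rpow_atTop (show (0 : ℝ) < 1 / 4 by norm_num)).bound one_pos,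
      eventually_ge_atTop 0] with y hb h0
    rw [one_mul, Real.norm_of_nonneg (Real.rpow_nonneg h0 _)] at hb
    exact (le_abs_self _).trans hb
  have hx : ∀ᶠ y : ℝ in atTop, 3 ≤ y ^ (1 / 4 : ℝ) :=
    (tendsto_rpow_atTop (by norm_num)).eventually_ge_atTop 3
  filter_upwards [hy.eventually hlog, hy.eventually hx, eventually_ge_atTop 0] with l h1 h2 h3
  have hl : 0 ≤ l + 3 := by linarith
  generalize hxx : (l + 3) ^ (1 / 4 : ℝ) = x at h1 h2
  have e4 : x ^ 4 = l + 3 := by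
    rw [← hxx, ← Real.rpow_natCast, ← Real.rpow_mul hl]
    norm_num
  have e2 : (l + 3) ^ (-(1 / 2) : ℝ) = (x ^ 2)⁻¹ := by
    rw [← hxx, ← Real.rpow_natCast, ← Real.rpow_mul hl, ← Real.rpow_neg hl]
    norm_num
  rw [e2, inv_mul_eq_div, le_div_iff₀ (by positivity)]
  -- With log (l + 3) ≤ x and l + 3 = x⁴, it suffices that 2x³ + x + 3 ≤ x⁴, true for x ≥ 3.
  have h4 : 2 * Real.log (l + 3) * x ^ 2 ≤ 2 * x * x ^ 2 := by gcongr
  have h5 : 3 * x ^ 3 ≤ x * x ^ 3 := by gcongr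
  have h6 : 3 ^ 2 * x ≤ x ^ 2 * x := by gcongr
  nlinarith

theorem inv_sq_le_exp {t L N : ℝ} (ht : 0 < t) (hl : 0 ≤ -Real.log t)
    (h : 2 * Real.log (-Real.log t + 3) ≤
      (-Real.log t + 3) ^ (-(1 / 2) : ℝ) * (-Real.log t - Real.log (-Real.log t + 3)))
    (hL0 : 0 < L) (hL : L ≤ -Real.log t + 3) (hN0 : 0 < N) (hN : N ≤ -Real.log t + 3) :
    (t ^ 2)⁻¹ ≤ Real.exp (-(2 + L ^ (-(1 / 2) : ℝ)) * (Real.log t + Real.log N)) := by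
  generalize hlt : -Real.log t = l at *
  have e : Real.log t = -l := by linarith
  have e2 : (t ^ 2)⁻¹ = Real.exp (2 * l) := by
    rw [← hlt, mul_neg, Real.exp_neg, two_mul, Real.exp_add, Real.exp_log ht, sq]
  have hlog0 : 0 ≤ Real.log (l + 3) := Real.log_nonneg (by linarith)
  have hNl : Real.log N ≤ Real.log (l + 3) := Real.log_le_log hN0 hN
  have hLl : (l + 3) ^ (-(1 / 2) : ℝ) ≤ L ^ (-(1 / 2) : ℝ) :=
    Real.rpow_le_rpow_of_nonpos hL0 hL (by norm_num)
  have hpos : 0 < (l + 3) ^ (-(1 / 2) : ℝ) := Real.rpow_pos_of_pos (by linarith) _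
  have hdiff : 0 ≤ l - Real.log (l + 3) :=
    nonneg_of_mul_nonneg_right (le_trans (by positivity) h) hpos
  rw [e2, e, Real.exp_le_exp]
  have h1 := mul_le_mul_of_nonneg_right hLl hdiff
  have h2 : L ^ (-(1 / 2) : ℝ) * (l - Real.log (l + 3)) ≤ L ^ (-(1 / 2) : ℝ) * (l - Real.log N) :=
    mul_le_mul_of_nonneg_left (by linarith) (hpos.le.trans hLl)
  linarith

/-- Non-tangential approach: in this sector 1 - |z| ≥ t/2, so L exceeds -log t by at most log 2. -/
theorem norm_one_sub_polar_le {t θ : ℝ} (h0 : 0 < t) (h1 : t ≤ 1 / 2) (hθ : |θ| < 1 / 2) :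
    ‖(1 : ℂ) - t * (Real.cos θ + Real.sin θ * Complex.I)‖ ≤ 1 - t / 2 := by
  refine abs_le_of_sq_le_sq' ?_ (by linarith) |>.2
  have hc : 7 / 8 ≤ Real.cos θ := by
    have := Real.one_sub_sq_div_two_le_cos (x := θ)
    have h2 : θ ^ 2 ≤ (1 / 2) ^ 2 := sq_le_sq' (by linarith [(abs_lt.1 hθ).1]) (abs_lt.1 hθ).2.le
    linarith
  have hcs := Real.sin_sq_add_cos_sq θ
  have e : ‖(1 : ℂ) - t * (Real.cos θ + Real.sin θ * Complex.I)‖ ^ 2 =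
      1 - 2 * t * Real.cos θ + t ^ 2 := by
    rw [← Complex.normSq_eq_norm_sq, Complex.normSq_apply]
    simp [-Complex.ofReal_cos, -Complex.ofReal_sin]
    linear_combination t ^ 2 * hcs
  rw [e]
  nlinarith

theorem lintegral_inv_Ioo_eq_top {δ : ℝ} (hδ : 0 < δ) :
    ∫⁻ t in Ioo 0 δ, ENNReal.ofReal t⁻¹ = ⊤ := by
  by_contra h
  have hi : IntegrableOn (fun t : ℝ => t⁻¹) (Ioo 0 δ) := by
    refine ⟨measurable_inv.aestronglyMeasurable, ?_⟩
    rw [hasFiniteIntegral_iff_ofReal]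
    · exact lt_top_iff_ne_top.2 h
    · filter_upwards [ae_restrict_mem measurableSet_Ioo] with t ht using inv_nonneg.2 ht.1.le
  have := (intervalIntegral.integrableOn_Ioo_rpow_iff (s := -1) hδ).1
    (by simpa [Real.rpow_neg_one] using hi)
  exact lt_irrefl _ this

theorem setLIntegral_disc_eq_top_of_sector {F : ℂ → ENNReal} {δ : ℝ} (h0 : 0 < δ)
    (hF : ∀ t ∈ Ioo 0 δ, ∀ θ ∈ Ioo (-(1 / 2) : ℝ) (1 / 2),
      1 - (t : ℂ) * (Real.cos θ + Real.sin θ * Complex.I) ∈ disc ∧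
      ENNReal.ofReal (t ^ 2)⁻¹ ≤ F (1 - t * (Real.cos θ + Real.sin θ * Complex.I))) :
    ∫⁻ z in disc, F z = ⊤ := by
  rw [← lintegral_indicator isOpen_disc.measurableSet,
    -- Polar coordinates centred at the boundary point 1; their Jacobian t turns t⁻² into t⁻¹.
    ← lintegral_sub_left_eq_self _ (1 : ℂ), ← Complex.lintegral_comp_polarCoord_symm]
  have hsub : Ioo 0 δ ×ˢ Ioo (-(1 / 2) : ℝ) (1 / 2) ⊆ polarCoord.target := by
    rw [polarCoord_target]
    refine prod_mono (fun t ht => ht.1) (Ioo_subset_Ioo ?_ ?_) <;> linarith [Real.pi_gt_three]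
  refine top_unique (le_trans ?_ (lintegral_mono_set hsub))
  have hle : ∫⁻ x in Ioo 0 δ ×ˢ Ioo (-(1 / 2) : ℝ) (1 / 2), ENNReal.ofReal x.1⁻¹ * 1 = ⊤ := by
    rw [Measure.volume_eq_prod, ← Measure.prod_restrict,
      lintegral_prod_mul (f := fun t : ℝ => ENNReal.ofReal t⁻¹) (g := fun _ => 1) (by fun_prop)
        (by fun_prop), lintegral_inv_Ioo_eq_top h0]
    simp
  rw [← hle]
  refine setLIntegral_mono' (measurableSet_Ioo.prod measurableSet_Ioo) ?_
  rintro ⟨t, θ⟩ ⟨ht, hθ⟩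
  obtain ⟨hd, hb⟩ := hF t ht θ hθ
  rw [Complex.polarCoord_symm_apply, indicator_of_mem hd, smul_eq_mul, mul_one]
  refine le_trans (le_of_eq ?_) (mul_le_mul_right hb _)
  have := ht.1
  rw [← ENNReal.ofReal_mul this.le]
  congr 1
  field_simp

theorem logPole_notMem_bergmanSpace {q : ℝ} (hq : 0 < q) {p : ℂ → ℝ} (hrad : IsRadial p) {R : ℝ}
    (hR1 : R < 1)
    (hp : ∀ r : ℝ, R ≤ r → r < 1 →
      p (r : ℂ) = q + (q / 2) * (-Real.log (1 - r)) ^ (-(1 / 2) : ℝ)) :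
    logPole q ∉ bergmanSpace p := by
  rintro ⟨-, -, h⟩
  rw [modular_lt_top_iff] at h
  refine h.ne ?_
  have hev : ∀ᶠ t : ℝ in 𝓝[>] 0, 2 * Real.log (-Real.log t + 3) ≤
      (-Real.log t + 3) ^ (-(1 / 2) : ℝ) * (-Real.log t - Real.log (-Real.log t + 3)) :=
    (tendsto_neg_atBot_atTop.comp Real.tendsto_log_nhdsGT_zero).eventually eventually_two_mul_log_le
  obtain ⟨ε, hε0, hε⟩ := mem_nhdsGT_iff_exists_Ioo_subset.1 hev
  rw [mem_Ioi] at hε0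
  refine setLIntegral_disc_eq_top_of_sector (δ := min ε (min (1 / 2) (1 - R)))
    (lt_min hε0 (lt_min (by norm_num) (by linarith))) ?_
  intro t ht θ hθ
  obtain ⟨ht0, htδ⟩ := ht
  rw [lt_min_iff, lt_min_iff] at htδ
  obtain ⟨htε, ht2, htR⟩ := htδ
  have hup := norm_one_sub_polar_le ht0 ht2.le (abs_lt.2 ⟨by linarith [hθ.1], hθ.2⟩)
  set w : ℂ := t * (Real.cos θ + Real.sin θ * Complex.I) with hw
  have hwn : ‖w‖ = t := by
    rw [hw, ← Complex.polarCoord_symm_apply (t, θ), Complex.norm_polarCoord_symm, abs_of_pos ht0]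
  have hwa : Complex.arg w = θ := by
    rw [hw, Complex.ofReal_cos, Complex.ofReal_sin]
    exact Complex.arg_mul_cos_add_sin_mul_I ht0
      ⟨by linarith [hθ.1, Real.pi_gt_three], by linarith [hθ.2, Real.pi_gt_three]⟩
  have hdisc : 1 - w ∈ disc := mem_disc_iff.2 (by linarith)
  have hlow : 1 - t ≤ ‖1 - w‖ := by
    have := norm_sub_norm_le (1 : ℂ) w
    rwa [norm_one, hwn] at this
  have hlt0 : Real.log t ≤ 0 := Real.log_nonpos ht0.le (by linarith)
  have hl1 : Real.log t - 1 ≤ Real.log (1 - ‖1 - w‖) := by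
    have h1 : Real.log (t / 2) ≤ Real.log (1 - ‖1 - w‖) :=
      Real.log_le_log (by positivity) (by linarith)
    rw [Real.log_div ht0.ne' two_ne_zero] at h1
    linarith [Real.log_two_lt_d9]
  have hL0 : 0 < -Real.log (1 - ‖1 - w‖) :=
    neg_pos.2 (Real.log_neg (by linarith) (by linarith))
  have hNre : (2 - Complex.log w).re = 2 - Real.log t := by rw [re_two_sub_log, hwn]
  have hN0 : 0 < ‖2 - Complex.log w‖ := by
    refine lt_of_lt_of_le ?_ (Complex.re_le_norm _)
    rw [hNre]
    linarith
  -- The 3 absorbs the constant 2 and the imaginary part, |θ| < 1/2.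
  have hN : ‖2 - Complex.log w‖ ≤ -Real.log t + 3 := by
    refine (Complex.norm_le_abs_re_add_abs_im _).trans ?_
    have him : (2 - Complex.log w).im = -θ := by simp [Complex.log_im, hwa]
    rw [hNre, him, abs_of_nonneg (by linarith), abs_neg]
    linarith [abs_lt.2 ⟨by linarith [hθ.1], hθ.2⟩]
  refine ⟨hdisc, ?_⟩
  rw [enorm_logPole_rpow, hrad _ hdisc, hp _ (by linarith) (by linarith), sub_sub_cancel, hwn]
  refine ENNReal.ofReal_le_ofReal ?_
  refine (inv_sq_le_exp ht0 (by linarith) (hε ⟨ht0, htε⟩) hL0 (by linarith) hN0 hN).trans_eq ?_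
  congr 2
  field_simp

/-! ### The limit of the exponent and an explicit example -/

theorem tendsto_exponent (q : ℝ) :
    Tendsto (fun r : ℝ => q + (q / 2) * (-Real.log (1 - r)) ^ (-(1 / 2) : ℝ)) (𝓝[<] 1) (𝓝 q) := by
  have h1 : Tendsto (fun r : ℝ => 1 - r) (𝓝[<] 1) (𝓝[>] 0) := by
    refine tendsto_nhdsWithin_iff.2 ⟨?_, ?_⟩
    · have : Tendsto (fun r : ℝ => 1 - r) (𝓝 1) (𝓝 (1 - 1)) := tendsto_id.const_sub 1
      rw [sub_self] at this
      exact this.mono_left nhdsWithin_le_nhds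
    · filter_upwards [self_mem_nhdsWithin] with r hr using sub_pos.2 (mem_Iio.1 hr)
  have h2 := tendsto_neg_atBot_atTop.comp (Real.tendsto_log_nhdsGT_zero.comp h1)
  have h3 := (tendsto_rpow_neg_atTop (show (0 : ℝ) < 1 / 2 by norm_num)).comp h2
  simpa using (h3.const_mul (q / 2)).const_add q

theorem tendsto_and_bergmanSpace_ne {q : ℝ} (hq : 0 < q) {p : ℂ → ℝ} (hrad : IsRadial p)
    (hp : ∃ R : ℝ, 0 < R ∧ R < 1 ∧ ∀ r : ℝ, R ≤ r → r < 1 →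
      p (r : ℂ) = q + (q / 2) * (-Real.log (1 - r)) ^ (-(1 / 2) : ℝ)) :
    Tendsto (fun r : ℝ => p (r : ℂ)) (𝓝[<] 1) (𝓝 q) ∧
      bergmanSpace p ≠ bergmanSpace (fun _ => q) := by
  obtain ⟨R, -, hR1, hp⟩ := hp
  constructor
  · refine (tendsto_exponent q).congr' ?_
    filter_upwards [Ioo_mem_nhdsLT hR1] with r hr using (hp r hr.1.le hr.2).symm
  · intro h
    exact logPole_notMem_bergmanSpace hq hrad hR1 hp (h ▸ logPole_mem_bergmanSpace_const hq)

/-- A globally bounded radial exponent which is given by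
`q + (q / 2) (-log (1 - |z|)) ^ (-1 / 2)` for `1 / 2 ≤ |z| < 1`. -/
noncomputable def logExponent (q : ℝ) (z : ℂ) : ℝ :=
  q + (q / 2) * (max (Real.log 2) (-Real.log (1 - ‖z‖))) ^ (-(1 / 2) : ℝ)

theorem le_logExponent {q : ℝ} (hq : 0 < q) (z : ℂ) : q ≤ logExponent q z := by
  have h : 0 ≤ max (Real.log 2) (-Real.log (1 - ‖z‖)) :=
    (Real.log_nonneg one_le_two).trans (le_max_left _ _)
  have := Real.rpow_nonneg h (-(1 / 2))
  rw [logExponent]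
  nlinarith

/-- The maximum with log 2 keeps the base of the negative power away from 0. -/
theorem logExponent_le {q : ℝ} (hq : 0 < q) (z : ℂ) :
    logExponent q z ≤ q + (q / 2) * Real.log 2 ^ (-(1 / 2) : ℝ) := by
  have h := Real.rpow_le_rpow_of_nonpos (Real.log_pos one_lt_two)
    (le_max_left (Real.log 2) (-Real.log (1 - ‖z‖))) (show (-(1 / 2) : ℝ) ≤ 0 by norm_num)
  rw [logExponent]
  gcongr

theorem isVariableExponent_logExponent {q : ℝ} (hq : 0 < q) :
    IsVariableExponent (logExponent q) where
  measurable := by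
    have : Measurable (logExponent q) := by
      unfold logExponent
      fun_prop
    exact this.comp measurable_subtype_coe
  essInf_pos := by
    refine lt_of_lt_of_le (EReal.coe_pos.2 hq) (le_essInf_of_ae_le _ ?_)
    exact ae_of_all _ fun z => EReal.coe_le_coe_iff.2 (le_logExponent hq z)
  essSup_lt_top := by
    refine lt_of_le_of_lt (essSup_le_of_ae_le _ ?_)
      (EReal.coe_lt_top (q + (q / 2) * Real.log 2 ^ (-(1 / 2) : ℝ)))
    exact ae_of_all _ fun z => EReal.coe_le_coe_iff.2 (logExponent_le hq z)

theorem isRadial_logExponent (q : ℝ) : IsRadial (logExponent q) := by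
  intro z _
  simp [logExponent]

theorem logExponent_ofReal (q : ℝ) {r : ℝ} (h : 1 / 2 ≤ r) (h1 : r < 1) :
    logExponent q r = q + (q / 2) * (-Real.log (1 - r)) ^ (-(1 / 2) : ℝ) := by
  have hl : Real.log 2 ≤ -Real.log (1 - r) := by
    rw [← Real.log_inv]
    refine Real.log_le_log two_pos ?_
    rw [le_inv_comm₀ two_pos (by linarith)]
    linarith
  rw [logExponent, Complex.norm_real, Real.norm_of_nonneg (by linarith), max_eq_right hl]

end VariableBergman

theorem mainTheorem11 (q : ℝ) (hq : 0 < q) :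
    -- there is a radial variable exponent `p ≥ q` with `p(r) → q` and `A^{p(·)} ≠ A^q`
    (∃ p : ℂ → ℝ,
        VariableBergman.IsVariableExponent p ∧
        VariableBergman.IsRadial p ∧
        (∀ z ∈ VariableBergman.disc, q ≤ p z) ∧
        Tendsto (fun r : ℝ => p (r : ℂ)) (𝓝[<] 1) (𝓝 q) ∧
        VariableBergman.bergmanSpace p ≠ VariableBergman.bergmanSpace (fun _ => q)) ∧
    -- every radial variable exponent given near the circle by the explicit formula is an example
    (∀ p : ℂ → ℝ,
        VariableBergman.IsVariableExponent p →
        VariableBergman.IsRadial p →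
        (∃ R : ℝ, 0 < R ∧ R < 1 ∧ ∀ r : ℝ, R ≤ r → r < 1 →
          p (r : ℂ) = q + (q / 2) * (-Real.log (1 - r)) ^ (-(1 / 2) : ℝ)) →
        Tendsto (fun r : ℝ => p (r : ℂ)) (𝓝[<] 1) (𝓝 q) ∧
        VariableBergman.bergmanSpace p ≠ VariableBergman.bergmanSpace (fun _ => q)) := by
  refine ⟨⟨VariableBergman.logExponent q, VariableBergman.isVariableExponent_logExponent hq,
    VariableBergman.isRadial_logExponent q, fun z _ => VariableBergman.le_logExponent hq z,
    VariableBergman.tendsto_and_bergmanSpace_ne hq (VariableBergman.isRadial_logExponent q)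
      ⟨1 / 2, by norm_num, by norm_num,
        fun r h h1 => VariableBergman.logExponent_ofReal q h h1⟩⟩,
    fun p _ hrad hp => VariableBergman.tendsto_and_bergmanSpace_ne hq hrad hp⟩
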